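/- For $k\in[0,1)$ let $K(k)=\int_0^{\pi/2}\frac{d\theta}{\sqrt{1-k^2\sin^2\theta}}$ be the complete elliptic integral of the first kind and let $\mathrm{cn}(\cdot,k)$ be the Jacobi elliptic cosine of modulus $k$. Fix $L>4\pi$. There is exactly one number $k_L\in(0,1)$ with $64K^2(k_L)\sqrt{k_L^4-k_L^2+1}=L^2$. For $k\in(0,k_L)$ put $$\tilde m(k)=L^2-64K^2(k)\sqrt{k^4-k^2+1},\qquad c(k)=\frac{L^2}{\tilde m(k)},$$ $$A(k)=\frac{-204800\,K^6(k)}{27\,\tilde m^3(k)}\left(\sqrt{k^4-k^2+1}-(2k^2-1)\right)^2\left(2\sqrt{k^4-k^2+1}+(2k^2-1)\right).$$ Then for each $k\in(0,k_L)$ one has $c(k)>1$, and the function $$\phi_k(x)=\left[\frac{5}{12}\left(\frac{L^2-64(2k^2-1)K^2(k)}{\tilde m(k)}-1\right)+\frac{80k^2K^2(k)}{\tilde m(k)}\,\mathrm{cn}^2\!\left(\frac{2K(k)}{L}x,k\right)\right]^2,\qquad x\in\mathbb R,$$ is a positive, smooth, $L$-periodic solution on $\mathbb R$ of $$-c\,\phi''+(c-1)\phi-\phi^{3/2}+A=0$$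 with $c=c(k)$ and $A=A(k)$. Moreover, the map $k\in(0,k_L)\mapsto\phi_k\in C^\infty_{per}([0,L])$ is smooth, where $C^\infty_{per}([0,L])$ is the Fréchet space of smooth $L$-periodic functions $\mathbb R\to\mathbb R$ with the seminorms $f\mapsto\max_{x\in[0,L]}|f^{(j)}(x)|$, $j=0,1,2,\dots$; that is, derivatives of all orders in $k$ exist as limits of difference quotients in this space. -/

import Mathlib

open Set Filter Topology
open scoped ContDiff

namespace Schamel

/-! ### Elliptic integrals and the Jacobi cosine amplitude (argument: the modulus `k`, not `k ^ 2`) -/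

/-- The incomplete elliptic integral of the first kind with amplitude `φ` and modulus `k`. -/
noncomputable def ellipticF (φ k : ℝ) : ℝ :=
  ∫ θ in (0 : ℝ)..φ, 1 / Real.sqrt (1 - k ^ 2 * Real.sin θ ^ 2)

/-- The complete elliptic integral of the first kind with modulus `k`. -/
noncomputable def ellipticK (k : ℝ) : ℝ := ellipticF (Real.pi / 2) k

/-- The Jacobi amplitude: for `k ^ 2 < 1`, `jacobiAm u k` is the unique `φ` with
`ellipticF φ k = u` (see `ellipticF_bijective` and `ellipticF_jacobiAm`). -/
noncomputable def jacobiAm (u k : ℝ) : ℝ := Function.invFun (fun φ => ellipticF φ k) u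

/-- The Jacobi elliptic function `cn (u, k)`. -/
noncomputable def jacobiCN (u k : ℝ) : ℝ := Real.cos (jacobiAm u k)

lemma one_sub_pos {k : ℝ} (hk : k ^ 2 < 1) (θ : ℝ) : 0 < 1 - k ^ 2 * Real.sin θ ^ 2 := by
  have h1 := Real.sin_sq_le_one θ
  have h2 : k ^ 2 * Real.sin θ ^ 2 ≤ k ^ 2 * 1 := by gcongr
  linarith

lemma continuous_integrand {k : ℝ} (hk : k ^ 2 < 1) :
    Continuous fun θ : ℝ => 1 / Real.sqrt (1 - k ^ 2 * Real.sin θ ^ 2) := by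
  refine continuous_const.div (by fun_prop) fun θ => ?_
  exact (Real.sqrt_pos.2 (one_sub_pos hk θ)).ne'

lemma one_le_integrand {k : ℝ} (hk : k ^ 2 < 1) (θ : ℝ) :
    1 ≤ 1 / Real.sqrt (1 - k ^ 2 * Real.sin θ ^ 2) := by
  rw [le_div_iff₀ (Real.sqrt_pos.2 (one_sub_pos hk θ)), one_mul]
  exact Real.sqrt_le_one.2 (by nlinarith [mul_nonneg (sq_nonneg k) (sq_nonneg (Real.sin θ))])

lemma sub_le_ellipticF_sub {k : ℝ} (hk : k ^ 2 < 1) {a b : ℝ} (hab : a ≤ b) :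
    b - a ≤ ellipticF b k - ellipticF a k := by
  have hi := fun x y : ℝ => (continuous_integrand hk).intervalIntegrable (μ := MeasureTheory.volume) x y
  have h1 : ellipticF b k - ellipticF a k =
      ∫ θ in a..b, 1 / Real.sqrt (1 - k ^ 2 * Real.sin θ ^ 2) :=
    intervalIntegral.integral_interval_sub_left (hi _ _) (hi _ _)
  have h2 : ∫ _ in a..b, (1 : ℝ) ≤ ∫ θ in a..b, 1 / Real.sqrt (1 - k ^ 2 * Real.sin θ ^ 2) :=
    intervalIntegral.integral_mono_on hab (by simp) (hi _ _) fun θ _ => one_le_integrand hk θ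
  rw [h1]
  simpa using h2

lemma ellipticF_bijective {k : ℝ} (hk : k ^ 2 < 1) :
    Function.Bijective fun φ => ellipticF φ k := by
  have h0 : ellipticF 0 k = 0 := by simp [ellipticF]
  have hmono : StrictMono fun φ => ellipticF φ k := by
    intro a b hab
    have := sub_le_ellipticF_sub hk hab.le
    simp only
    linarith
  have hcont : Continuous fun φ => ellipticF φ k :=
    intervalIntegral.continuous_primitive
      (fun a b => (continuous_integrand hk).intervalIntegrable a b) 0
  refine ⟨hmono.injective, hcont.surjective ?_ ?_⟩
  · refine tendsto_atTop_mono' _ ?_ tendsto_id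
    filter_upwards [eventually_ge_atTop (0 : ℝ)] with x hx
    have := sub_le_ellipticF_sub hk hx
    simp only [id]
    linarith
  · refine tendsto_atBot_mono' _ ?_ tendsto_id
    filter_upwards [eventually_le_atBot (0 : ℝ)] with x hx
    have := sub_le_ellipticF_sub hk hx
    simp only [id]
    linarith

lemma ellipticF_jacobiAm {k : ℝ} (hk : k ^ 2 < 1) (u : ℝ) : ellipticF (jacobiAm u k) k = u :=
  Function.rightInverse_invFun (ellipticF_bijective hk).2 u

/-! ### The Fréchet space of smooth periodic functions -/

/-- The real vector space of smooth `L`-periodic functions on the line. -/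
def smoothPeriodicSubmodule (L : ℝ) : Submodule ℝ (ℝ → ℝ) where
  carrier := {f | ContDiff ℝ ∞ f ∧ Function.Periodic f L}
  zero_mem' := ⟨contDiff_const, fun _ => rfl⟩
  add_mem' hf hg := ⟨hf.1.add hg.1, hf.2.add hg.2⟩
  smul_mem' a _ hf := ⟨contDiff_const.smul hf.1, fun x => congrArg (a • ·) (hf.2 x)⟩

/-- The space `C^∞_per([0, L])`; it is a type of its own, so that it does not inherit the topology of
pointwise convergence. -/
def SmoothPeriodic (L : ℝ) : Type := smoothPeriodicSubmodule L

namespace SmoothPeriodic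

variable {L : ℝ}

instance : AddCommGroup (SmoothPeriodic L) :=
  inferInstanceAs (AddCommGroup (smoothPeriodicSubmodule L))

instance : Module ℝ (SmoothPeriodic L) :=
  inferInstanceAs (Module ℝ (smoothPeriodicSubmodule L))

instance : CoeFun (SmoothPeriodic L) (fun _ => ℝ → ℝ) := ⟨Subtype.val⟩

/-- The restriction to `[0, L]` of the `j`-th derivative. -/
noncomputable def derivRestrict (L : ℝ) (j : ℕ) : SmoothPeriodic L →ₗ[ℝ] C(Icc (0 : ℝ) L, ℝ) where
  toFun f := ⟨fun x => iteratedDeriv j f x,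
    (f.2.1.continuous_iteratedDeriv j (mod_cast le_top)).comp continuous_subtype_val⟩
  map_add' f g := by
    ext x
    exact iteratedDeriv_add (f.2.1.contDiffAt.of_le (mod_cast le_top))
      (g.2.1.contDiffAt.of_le (mod_cast le_top))
  map_smul' a f := by
    ext x
    exact iteratedDeriv_const_smul (f.2.1.contDiffAt.of_le (mod_cast le_top)) a

/-- The seminorms `f ↦ max_{0 ≤ x ≤ L} |f⁽ʲ⁾(x)|`, `j = 0, 1, 2, …`. -/
noncomputable def seminorms (L : ℝ) : SeminormFamily ℝ (SmoothPeriodic L) ℕ :=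
  fun j => (normSeminorm ℝ C(Icc (0 : ℝ) L, ℝ)).comp (derivRestrict L j)

/-- The usual Fréchet topology: uniform convergence of all derivatives. -/
noncomputable instance : TopologicalSpace (SmoothPeriodic L) :=
  (seminorms L).moduleFilterBasis.topology

lemma withSeminorms : WithSeminorms (seminorms L) := ⟨rfl⟩

end SmoothPeriodic

/-- Smoothness, on an open set `s` of real parameters, of a curve `γ` in a topological vector space:
derivatives of all orders exist on `s`, each one as the limit of difference quotients of the
preceding one (`D n` is the `n`-th derivative). -/
def IsSmoothCurveOn {E : Type*} [AddCommGroup E] [Module ℝ E] [TopologicalSpace E]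
    (γ : ℝ → E) (s : Set ℝ) : Prop :=
  ∃ D : ℕ → ℝ → E, (∀ t ∈ s, D 0 t = γ t) ∧
    ∀ n, ∀ t ∈ s, Tendsto (fun h : ℝ => h⁻¹ • (D n (t + h) - D n t)) (𝓝[≠] 0) (𝓝 (D (n + 1) t))

/-! ### The travelling waves -/

/-- `φ` solves `-c φ'' + (c - 1) φ - φ^(3/2) + A = 0` on the whole line. -/
def SolvesWaveODE (c A : ℝ) (φ : ℝ → ℝ) : Prop :=
  ∀ x : ℝ, -c * deriv (deriv φ) x + (c - 1) * φ x - φ x ^ (3 / 2 : ℝ) + A = 0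

/-- The function `g(k) = 64 K(k)² √(k⁴ - k² + 1)`. -/
noncomputable def g (k : ℝ) : ℝ := 64 * ellipticK k ^ 2 * Real.sqrt (k ^ 4 - k ^ 2 + 1)

/-- `m̃(k) = L² - 64 K(k)² √(k⁴ - k² + 1)`. -/
noncomputable def mTilde (L k : ℝ) : ℝ :=
  L ^ 2 - 64 * ellipticK k ^ 2 * Real.sqrt (k ^ 4 - k ^ 2 + 1)

/-- The wave speed `c(k)`. -/
noncomputable def waveSpeed (L k : ℝ) : ℝ :=
  L ^ 2 / (L ^ 2 - 64 * ellipticK k ^ 2 * Real.sqrt (k ^ 4 - k ^ 2 + 1))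

/-- The integration constant `A(k)`. -/
noncomputable def waveA (L k : ℝ) : ℝ :=
  -204800 * ellipticK k ^ 6 / (27 * mTilde L k ^ 3) *
    ((Real.sqrt (k ^ 4 - k ^ 2 + 1) - (2 * k ^ 2 - 1)) ^ 2 *
      (2 * Real.sqrt (k ^ 4 - k ^ 2 + 1) + (2 * k ^ 2 - 1)))

/-- The cnoidal wave profile `φ_k`. -/
noncomputable def phi (L k x : ℝ) : ℝ :=
  (5 / 12 * ((L ^ 2 - 64 * (2 * k ^ 2 - 1) * ellipticK k ^ 2) / mTilde L k - 1) +
    80 * k ^ 2 * ellipticK k ^ 2 / mTilde L k * jacobiCN (2 * ellipticK k / L * x) k ^ 2) ^ 2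

end Schamel

/-! The profile is a square `φ = w²` with `w = waveRoot > 0`, so `φ^(3/2) = w³`. Write `p = k²`, `R
= √(k⁴ - k² + 1)`, `κ = K²/m̃`, `y = cn²`. Then `w` is affine in `y`, `y'²` is a cubic in `y` and
`y''` a quadratic, while the scaling of the argument and the definition of `c` turn `c` and `c - 1`
into multiples of `κ` and `κR`. The differential equation thus becomes a polynomial identity in `y`,
valid because `R² = p² - p + 1` (`wave_identity`).

The number `k_L` exists and is unique because `g` increases strictly from `16π² < L²` at `0` to
values above `L²`. For the monotonicity, `g = 64 · K²(2 - k²) · R/(2 - k²)`: the first `k`-dependent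
factor is nondecreasing by a symmetrized integral formula for `K`, the second is strictly increasing
by algebra. Hence `m̃ = g(k_L) - g(k) > 0` below `k_L`, which gives `c > 1`.

For smoothness in `k`, the amplitude is jointly smooth in argument and modulus by the inverse
function theorem, so `(k, x) ↦ φ_k(x)` is jointly smooth. A jointly smooth family, periodic in `x`,
is a smooth curve in the Fréchet space, since difference quotients converge uniformly on compact
sets and `∂_k` commutes with `∂_x`. -/

namespace Schamel

/-! ### Smoothness of integrals depending on a parameter -/

section ParametricIntegral

lemma continuousOn_parametric_integral {E G : Type} [NormedAddCommGroup E] [NormedAddCommGroup G]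
    [NormedSpace ℝ G] {U : Set E} {f : E × ℝ → G} (hf : ContinuousOn f (U ×ˢ univ)) (a b : ℝ) :
    ContinuousOn (fun x => ∫ s in a..b, f (x, s)) U := by
  rw [continuousOn_iff_continuous_domRestrict]
  refine intervalIntegral.continuous_parametric_intervalIntegral_of_continuous'
    (f := fun (x : U) s => f (x, s)) ?_ a b
  exact hf.comp_continuous (by fun_prop) fun p => ⟨p.1.2, trivial⟩

variable {E : Type} [NormedAddCommGroup E] [NormedSpace ℝ E]

lemma hasFDerivAt_parametric_integral {G : Type} [NormedAddCommGroup G] [NormedSpace ℝ G]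
    {U : Set E} (hU : IsOpen U) {f : E × ℝ → G} {f' : E × ℝ → E →L[ℝ] G}
    (hf : ContinuousOn f (U ×ˢ univ)) (hf' : ContinuousOn f' (U ×ˢ univ))
    (hd : ∀ x ∈ U, ∀ s, HasFDerivAt (fun y => f (y, s)) (f' (x, s)) x) (a b : ℝ)
    {x : E} (hx : x ∈ U) :
    HasFDerivAt (fun y => ∫ s in a..b, f (y, s)) (∫ s in a..b, f' (x, s)) x := by
  have hc : ∀ {H : Type} [NormedAddCommGroup H] {g : E × ℝ → H}, ContinuousOn g (U ×ˢ univ) →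
      ∀ y ∈ U, Continuous fun s => g (y, s) := fun hg y hy =>
    hg.comp_continuous (by fun_prop) fun s => ⟨hy, trivial⟩
  obtain ⟨C, hC⟩ := (isCompact_uIcc (a := a) (b := b)).exists_bound_of_continuousOn
    (hc hf' x hx).continuousOn
  -- Compactness of the segment makes the bound on `f'` along `{x} × [a, b]` persist, up to `1`, for
  -- all nearby `y`; the constant `C + 1` then dominates.
  have hev : ∀ᶠ y in 𝓝 x, ∀ s ∈ uIcc a b, ‖f' (y, s)‖ < C + 1 := by
    refine isCompact_uIcc.eventually_forall_of_forall_eventually fun s hs => ?_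
    have hat : ContinuousAt f' (x, s) :=
      hf'.continuousAt ((hU.prod isOpen_univ).mem_nhds ⟨hx, trivial⟩)
    exact hat.norm.eventually_lt continuousAt_const (lt_of_le_of_lt (hC s hs) (lt_add_one C))
  refine intervalIntegral.hasFDerivAt_integral_of_dominated_of_fderiv_le (𝕜 := ℝ)
    (F := fun y s => f (y, s)) (F' := fun y s => f' (y, s)) (bound := fun _ => C + 1)
    (hev.and (hU.mem_nhds hx)) ?_ ((hc hf x hx).intervalIntegrable a b)
    (hc hf' x hx).aestronglyMeasurable ?_ intervalIntegrable_const ?_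
  · filter_upwards [hU.mem_nhds hx] with y hy
    exact (hc hf y hy).aestronglyMeasurable
  · exact .of_forall fun s hs y hy => (hy.1 s (uIoc_subset_uIcc hs)).le
  · exact .of_forall fun s _ y hy => hd y hy.2 s

/-- Differentiation under the integral replaces `G` by `E →L[ℝ] G`, so the induction must quantify
over the target space. -/
lemma contDiffOn_parametric_integral_nat {U : Set E} (hU : IsOpen U) (a b : ℝ) (n : ℕ) :
    ∀ {G : Type} [NormedAddCommGroup G] [NormedSpace ℝ G] {f : E × ℝ → G},
      ContDiffOn ℝ n f (U ×ˢ univ) → ContDiffOn ℝ n (fun x => ∫ s in a..b, f (x, s)) U := by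
  induction n with
  | zero =>
    intro G _ _ f hf
    exact contDiffOn_zero.2 (continuousOn_parametric_integral hf.continuousOn a b)
  | succ n ih =>
    intro G _ _ f hf
    have hO : IsOpen (U ×ˢ (univ : Set ℝ)) := hU.prod isOpen_univ
    set f' : E × ℝ → E →L[ℝ] G := fun p => (fderiv ℝ f p).comp (ContinuousLinearMap.inl ℝ E ℝ)
    have hf' : ContDiffOn ℝ n f' (U ×ˢ univ) :=
      (hf.fderiv_of_isOpen hO (mod_cast le_rfl)).clm_comp contDiffOn_const
    have hd : ∀ x ∈ U, ∀ s, HasFDerivAt (fun y => f (y, s)) (f' (x, s)) x := by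
      intro x hx s
      have h1 : HasFDerivAt f (fderiv ℝ f (x, s)) (x, s) :=
        ((hf.contDiffAt (hO.mem_nhds ⟨hx, trivial⟩)).differentiableAt
          (by simp)).hasFDerivAt
      exact h1.comp x (hasFDerivAt_prodMk_left x s)
    have key := fun x hx =>
      hasFDerivAt_parametric_integral hU hf.continuousOn hf'.continuousOn hd a b (x := x) hx
    push_cast
    rw [contDiffOn_succ_iff_fderiv_of_isOpen hU]
    refine ⟨fun x hx => (key x hx).differentiableAt.differentiableWithinAt, by simp, ?_⟩
    exact (ih hf').congr fun x hx => (key x hx).fderiv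

lemma contDiffOn_parametric_integral {G : Type} [NormedAddCommGroup G] [NormedSpace ℝ G]
    {U : Set E} (hU : IsOpen U) {f : E × ℝ → G} (hf : ContDiffOn ℝ ∞ f (U ×ˢ univ)) (a b : ℝ) :
    ContDiffOn ℝ ∞ (fun x => ∫ s in a..b, f (x, s)) U :=
  contDiffOn_infty.2 fun n =>
    contDiffOn_parametric_integral_nat hU a b n (hf.of_le (mod_cast le_top))

end ParametricIntegral

/-! ### The elliptic integral and the amplitude as functions of two variables -/

lemma isOpen_modulus : IsOpen {p : ℝ × ℝ | p.2 ^ 2 < 1} :=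
  isOpen_lt (by fun_prop) continuous_const

/-- The substitution `θ = φ s` moves the variable endpoint into the integrand, leaving an integral
over the fixed interval `[0, 1]`. -/
lemma contDiffOn_ellipticF :
    ContDiffOn ℝ ∞ (fun p : ℝ × ℝ => ellipticF p.1 p.2) {p | p.2 ^ 2 < 1} := by
  have h1 : ∀ p : ℝ × ℝ, ellipticF p.1 p.2 =
      p.1 * ∫ s in (0 : ℝ)..1, 1 / Real.sqrt (1 - p.2 ^ 2 * Real.sin (p.1 * s) ^ 2) := by
    intro p
    rw [intervalIntegral.mul_integral_comp_mul_left
      (f := fun θ => 1 / Real.sqrt (1 - p.2 ^ 2 * Real.sin θ ^ 2))]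
    simp [ellipticF]
  simp only [h1]
  refine contDiff_fst.contDiffOn.mul (contDiffOn_parametric_integral isOpen_modulus
    (f := fun q : (ℝ × ℝ) × ℝ => 1 / Real.sqrt (1 - q.1.2 ^ 2 * Real.sin (q.1.1 * q.2) ^ 2)) ?_ 0 1)
  have hpos : ∀ q ∈ {p : ℝ × ℝ | p.2 ^ 2 < 1} ×ˢ (univ : Set ℝ),
      0 < 1 - q.1.2 ^ 2 * Real.sin (q.1.1 * q.2) ^ 2 := fun q hq => one_sub_pos hq.1 _
  refine contDiffOn_const.div (ContDiffOn.sqrt ?_ fun q hq => (hpos q hq).ne') fun q hq =>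
    (Real.sqrt_pos.2 (hpos q hq)).ne'
  refine ContDiff.contDiffOn ?_
  have : ContDiff ℝ ∞ fun q : (ℝ × ℝ) × ℝ => Real.sin (q.1.1 * q.2) :=
    Real.contDiff_sin.comp (by fun_prop)
  fun_prop

lemma hasDerivAt_ellipticF {k : ℝ} (hk : k ^ 2 < 1) (φ : ℝ) :
    HasDerivAt (fun φ => ellipticF φ k) (1 / Real.sqrt (1 - k ^ 2 * Real.sin φ ^ 2)) φ :=
  ((continuous_integrand hk).integral_hasStrictDerivAt 0 φ).hasDerivAt

lemma jacobiAm_ellipticF {k : ℝ} (hk : k ^ 2 < 1) (φ : ℝ) : jacobiAm (ellipticF φ k) k = φ :=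
  Function.leftInverse_invFun (ellipticF_bijective hk).1 φ

/-- The shear `(x, y) ↦ (a x + b y, y)`, as a linear equivalence. -/
noncomputable def shearEquiv (a b : ℝ) (ha : a ≠ 0) : (ℝ × ℝ) ≃L[ℝ] (ℝ × ℝ) :=
  LinearEquiv.toContinuousLinearEquiv
    { toFun := fun p => (a * p.1 + b * p.2, p.2)
      invFun := fun p => ((p.1 - b * p.2) / a, p.2)
      map_add' := fun p q => by ext <;> simp; ring
      map_smul' := fun c p => by ext <;> simp; ring
      left_inv := fun p => by ext <;> simp [ha]
      right_inv := fun p => by ext <;> simp; field_simp; ring }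

/-- Inverse function theorem for `(φ, k) ↦ (F(φ, k), k)`: its derivative is a shear with diagonal
entry `∂F/∂φ ≠ 0`. -/
lemma contDiffOn_jacobiAm :
    ContDiffOn ℝ ∞ (fun p : ℝ × ℝ => jacobiAm p.1 p.2) {p | p.2 ^ 2 < 1} := by
  intro q hq
  refine ContDiffAt.contDiffWithinAt ?_
  obtain ⟨u, k⟩ := q
  have hk : k ^ 2 < 1 := hq
  set φ := jacobiAm u k with hφ
  have hFφ : ellipticF φ k = u := ellipticF_jacobiAm hk u
  set Ψ : ℝ × ℝ → ℝ × ℝ := fun p => (ellipticF p.1 p.2, p.2) with hΨ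
  have hF : ContDiffAt ℝ ∞ (fun p : ℝ × ℝ => ellipticF p.1 p.2) (φ, k) :=
    contDiffOn_ellipticF.contDiffAt (isOpen_modulus.mem_nhds hk)
  have hΨc : ContDiffAt ℝ ∞ Ψ (φ, k) := hF.prodMk contDiffAt_snd
  have hFd := (hF.differentiableAt (by simp)).hasFDerivAt
  set D := fderiv ℝ (fun p : ℝ × ℝ => ellipticF p.1 p.2) (φ, k)
  have hD1 : D (1, 0) = 1 / Real.sqrt (1 - k ^ 2 * Real.sin φ ^ 2) := by
    have h2 : HasDerivAt (fun t : ℝ => (t, k)) ((1 : ℝ), (0 : ℝ)) φ :=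
      (hasDerivAt_id φ).prodMk (hasDerivAt_const φ k)
    exact (HasFDerivAt.comp_hasDerivAt (f := fun t : ℝ => (t, k)) φ hFd h2).unique
      (hasDerivAt_ellipticF hk φ)
  have hD0 : D (1, 0) ≠ 0 := by
    rw [hD1]
    exact (one_div_pos.2 (Real.sqrt_pos.2 (one_sub_pos hk φ))).ne'
  have hΨd : HasFDerivAt Ψ
      (shearEquiv (D (1, 0)) (D (0, 1)) hD0 : (ℝ × ℝ) →L[ℝ] (ℝ × ℝ)) (φ, k) := by
    refine (hFd.prodMk hasFDerivAt_snd).congr_fderiv ?_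
    ext <;> simp [shearEquiv]
  have hΨu : Ψ (φ, k) = (u, k) := by simp [hΨ, hFφ]
  have hs := hΨc.hasStrictFDerivAt' hΨd (by simp)
  have hinv := hΨc.to_localInverse hΨd (by simp)
  have hr := hs.eventually_right_inverse
  rw [hΨu] at hinv hr
  have hfst : ContDiffAt ℝ ∞ (fun p => (hΨc.localInverse hΨd (by simp) p).1) (u, k) := hinv.fst
  refine hfst.congr_of_eventuallyEq ?_
  -- The local inverse is a right inverse near `(u, k)`, so injectivity of `F(·, k)` identifies its
  -- first component with the amplitude.
  filter_upwards [hr, isOpen_modulus.mem_nhds (show (u, k) ∈ {p : ℝ × ℝ | p.2 ^ 2 < 1} from hk)]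
    with p hp hpk
  have hp' : Ψ (hΨc.localInverse hΨd (by simp) p) = p := hp
  set w := hΨc.localInverse hΨd (by simp) p
  have h2 : w.2 = p.2 := by simpa [hΨ] using congrArg Prod.snd hp'
  have h1 : ellipticF w.1 w.2 = p.1 := by simpa [hΨ] using congrArg Prod.fst hp'
  rw [h2] at h1
  rw [← h1]
  exact jacobiAm_ellipticF hpk w.1

end Schamel

namespace Schamel

/-! ### The amplitude and the Jacobi functions for a fixed modulus -/

lemma sq_lt_one_of_mem {k : ℝ} (hk : k ∈ Ioo (0 : ℝ) 1) : k ^ 2 < 1 := by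
  have := hk.1; have := hk.2; nlinarith

lemma contDiff_jacobiAm {k : ℝ} (hk : k ^ 2 < 1) : ContDiff ℝ ∞ fun u => jacobiAm u k := by
  have h : ContDiff ℝ ∞ fun u : ℝ => (u, k) := by fun_prop
  exact ContDiffOn.comp_contDiff (g := fun p : ℝ × ℝ => jacobiAm p.1 p.2) (f := fun u => (u, k))
    (s := {p : ℝ × ℝ | p.2 ^ 2 < 1}) contDiffOn_jacobiAm h fun _ => hk

lemma hasDerivAt_jacobiAm {k : ℝ} (hk : k ^ 2 < 1) (u : ℝ) :
    HasDerivAt (fun u => jacobiAm u k)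
      (Real.sqrt (1 - k ^ 2 * Real.sin (jacobiAm u k) ^ 2)) u := by
  have hs := (Real.sqrt_pos.2 (one_sub_pos hk (jacobiAm u k))).ne'
  have := HasDerivAt.of_local_left_inverse (g := fun u => jacobiAm u k)
    (f := fun φ => ellipticF φ k) (contDiff_jacobiAm hk).continuous.continuousAt
    (hasDerivAt_ellipticF hk (jacobiAm u k)) (one_div_ne_zero hs)
    (.of_forall fun v => ellipticF_jacobiAm hk v)
  simpa using this

/-- The integrand has period `π` and is symmetric about `π/2`, so a full period contributes `2K`. -/
lemma ellipticF_add_pi {k : ℝ} (hk : k ^ 2 < 1) (φ : ℝ) :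
    ellipticF (φ + Real.pi) k = ellipticF φ k + 2 * ellipticK k := by
  have hi := fun x y : ℝ =>
    (continuous_integrand hk).intervalIntegrable (μ := MeasureTheory.volume) x y
  have hper : Function.Periodic (fun θ : ℝ => 1 / Real.sqrt (1 - k ^ 2 * Real.sin θ ^ 2))
      Real.pi := fun θ => by simp [Real.sin_add_pi]
  have h1 : ∫ θ in (Real.pi / 2)..Real.pi, 1 / Real.sqrt (1 - k ^ 2 * Real.sin θ ^ 2) =
      ellipticK k := by
    have := intervalIntegral.integral_comp_sub_left (a := 0) (b := Real.pi / 2)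
      (fun θ => 1 / Real.sqrt (1 - k ^ 2 * Real.sin θ ^ 2)) Real.pi
    simp only [Real.sin_pi_sub, sub_zero] at this
    rw [show Real.pi / 2 = Real.pi - Real.pi / 2 by ring, ← this]
    simp [ellipticK, ellipticF]
  have h2 := hper.intervalIntegral_add_eq φ 0
  rw [zero_add, ← intervalIntegral.integral_add_adjacent_intervals (hi 0 (Real.pi / 2)) (hi _ _),
    h1] at h2
  have h3 := intervalIntegral.integral_add_adjacent_intervals (hi 0 φ) (hi φ (φ + Real.pi))
  rw [h2] at h3
  rw [ellipticF, ← h3]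
  simp only [ellipticF, ellipticK]
  ring

lemma jacobiAm_add {k : ℝ} (hk : k ^ 2 < 1) (u : ℝ) :
    jacobiAm (u + 2 * ellipticK k) k = jacobiAm u k + Real.pi := by
  conv_lhs => rw [← ellipticF_jacobiAm hk u, ← ellipticF_add_pi hk]
  exact jacobiAm_ellipticF hk _

lemma jacobiCN_sq_add {k : ℝ} (hk : k ^ 2 < 1) (u : ℝ) :
    jacobiCN (u + 2 * ellipticK k) k ^ 2 = jacobiCN u k ^ 2 := by
  simp [jacobiCN, jacobiAm_add hk, Real.cos_add_pi]

/-- The derivative of `cn² u` in `u`. -/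
noncomputable def cnSqDeriv (u k : ℝ) : ℝ :=
  -2 * Real.cos (jacobiAm u k) * Real.sin (jacobiAm u k) *
    Real.sqrt (1 - k ^ 2 * Real.sin (jacobiAm u k) ^ 2)

lemma hasDerivAt_jacobiCN_sq {k : ℝ} (hk : k ^ 2 < 1) (u : ℝ) :
    HasDerivAt (fun u => jacobiCN u k ^ 2) (cnSqDeriv u k) u := by
  refine ((hasDerivAt_jacobiAm hk u).cos.pow 2).congr_deriv ?_
  simp [cnSqDeriv]
  ring

/-- With `hasDerivAt_cnSqDeriv`, whose value is half the derivative of this cubic in `cn²`, this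
removes all elliptic functions from the wave equation. -/
lemma cnSqDeriv_sq {k : ℝ} (hk : k ^ 2 < 1) (u : ℝ) :
    cnSqDeriv u k ^ 2 = 4 * jacobiCN u k ^ 2 * (1 - jacobiCN u k ^ 2) *
      (1 - k ^ 2 + k ^ 2 * jacobiCN u k ^ 2) := by
  have h1 := Real.sq_sqrt (one_sub_pos hk (jacobiAm u k)).le
  have h2 := Real.sin_sq (jacobiAm u k)
  simp only [cnSqDeriv, jacobiCN, mul_pow, h1]
  rw [h2]
  ring

lemma hasDerivAt_cnSqDeriv {k : ℝ} (hk : k ^ 2 < 1) (u : ℝ) :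
    HasDerivAt (fun u => cnSqDeriv u k)
      (2 * ((1 - 2 * jacobiCN u k ^ 2) * (1 - k ^ 2 + k ^ 2 * jacobiCN u k ^ 2) +
        k ^ 2 * jacobiCN u k ^ 2 * (1 - jacobiCN u k ^ 2))) u := by
  have hp := one_sub_pos hk (jacobiAm u k)
  have ha := hasDerivAt_jacobiAm hk u
  have hs := (((ha.sin.pow 2).const_mul (k ^ 2)).const_sub 1).sqrt hp.ne'
  refine (((ha.cos.const_mul (-2)).mul ha.sin).mul hs).congr_deriv ?_
  have h1 := Real.sq_sqrt hp.le
  have h0 := (Real.sqrt_pos.2 hp).ne'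
  have h2 := Real.sin_sq (jacobiAm u k)
  simp only [jacobiCN]
  simp only [Pi.pow_apply, Pi.mul_apply]
  set d := Real.sqrt (1 - k ^ 2 * Real.sin (jacobiAm u k) ^ 2)
  set s := Real.sin (jacobiAm u k)
  set c := Real.cos (jacobiAm u k)
  field_simp
  rw [h2] at h1
  ring_nf
  have h3 : s ^ 2 = 1 - c ^ 2 := h2
  have h4 : d ^ 2 = 1 - k ^ 2 * (1 - c ^ 2) := h1
  simp only [h3, h4]
  ring

/-! ### The complete integral -/

lemma ellipticK_zero : ellipticK 0 = Real.pi / 2 := by simp [ellipticK, ellipticF]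

lemma pi_div_two_le_ellipticK {k : ℝ} (hk : k ^ 2 < 1) : Real.pi / 2 ≤ ellipticK k := by
  have := sub_le_ellipticF_sub hk (a := 0) (b := Real.pi / 2) (by positivity)
  have h0 : ellipticF 0 k = 0 := by simp [ellipticF]
  simpa [h0, ellipticK] using this

lemma ellipticK_pos {k : ℝ} (hk : k ^ 2 < 1) : 0 < ellipticK k :=
  lt_of_lt_of_le (by positivity) (pi_div_two_le_ellipticK hk)

lemma contDiffOn_ellipticK : ContDiffOn ℝ ∞ ellipticK {k | k ^ 2 < 1} := by
  have h : ContDiff ℝ ∞ fun k : ℝ => (Real.pi / 2, k) := by fun_prop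
  exact contDiffOn_ellipticF.comp h.contDiffOn fun k hk => hk

/-- The even convex function `t ↦ (1 + t)^(-1/2) + (1 - t)^(-1/2)` is increasing on `[0, 1)`. -/
lemma inv_sqrt_add_le {s t : ℝ} (hs : 0 ≤ s) (hst : s ≤ t) (ht : t < 1) :
    1 / Real.sqrt (1 + s) + 1 / Real.sqrt (1 - s) ≤
      1 / Real.sqrt (1 + t) + 1 / Real.sqrt (1 - t) := by
  -- Squaring the sum leaves an expression in `x²` alone, both of whose terms visibly increase.
  have h : ∀ x, 0 ≤ x → x < 1 → (1 / Real.sqrt (1 + x) + 1 / Real.sqrt (1 - x)) =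
      Real.sqrt (2 / (1 - x ^ 2) + 2 / Real.sqrt (1 - x ^ 2)) := by
    intro x hx0 hx1
    have hp : 0 < Real.sqrt (1 + x) := Real.sqrt_pos.2 (by linarith)
    have hm : 0 < Real.sqrt (1 - x) := Real.sqrt_pos.2 (by linarith)
    have hp2 := Real.sq_sqrt (show 0 ≤ 1 + x by linarith)
    have hm2 := Real.sq_sqrt (show 0 ≤ 1 - x by linarith)
    rw [eq_comm, Real.sqrt_eq_iff_mul_self_eq_of_pos (by positivity),
      show 1 - x ^ 2 = (1 + x) * (1 - x) by ring, Real.sqrt_mul (by linarith)]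
    set p := Real.sqrt (1 + x)
    set m := Real.sqrt (1 - x)
    rw [← hp2, ← hm2]
    field_simp
    linarith
  rw [h s hs (by linarith), h t (by linarith) ht]
  have h1 : 1 - t ^ 2 ≤ 1 - s ^ 2 := by nlinarith
  have h2 : 0 < 1 - t ^ 2 := by nlinarith
  have h3 : 0 < Real.sqrt (1 - t ^ 2) := Real.sqrt_pos.2 h2
  gcongr

lemma inv_sqrt_add_le_of_abs_le_one {s t c : ℝ} (hs : 0 ≤ s) (hst : s ≤ t) (ht : t < 1)
    (hc : |c| ≤ 1) :
    1 / Real.sqrt (1 + s * c) + 1 / Real.sqrt (1 - s * c) ≤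
      1 / Real.sqrt (1 + t * c) + 1 / Real.sqrt (1 - t * c) := by
  have key : ∀ d, 0 ≤ d → d ≤ 1 → 1 / Real.sqrt (1 + s * d) + 1 / Real.sqrt (1 - s * d) ≤
      1 / Real.sqrt (1 + t * d) + 1 / Real.sqrt (1 - t * d) := fun d h0 h1 =>
    inv_sqrt_add_le (mul_nonneg hs h0) (mul_le_mul_of_nonneg_right hst h0) (by nlinarith)
  obtain ⟨h1, h2⟩ := abs_le.1 hc
  rcases le_total 0 c with h0 | h0
  · exact key c h0 h2
  · have := key (-c) (by linarith) (by linarith)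
    simp only [mul_neg, sub_neg_eq_add, ← sub_eq_add_neg] at this
    linarith

/-- The complete integral in terms of the parameter `k² / (2 - k²)`, in a form that is visibly
increasing. -/
lemma ellipticK_mul_sqrt {k : ℝ} (hk : k ^ 2 < 1) :
    2 * (ellipticK k * Real.sqrt ((2 - k ^ 2) / 2)) = ∫ θ in (0 : ℝ)..(Real.pi / 2),
      (1 / Real.sqrt (1 + k ^ 2 / (2 - k ^ 2) * Real.cos (2 * θ)) +
        1 / Real.sqrt (1 - k ^ 2 / (2 - k ^ 2) * Real.cos (2 * θ))) := by
  set t := k ^ 2 / (2 - k ^ 2) with ht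
  have h2k : 0 < 2 - k ^ 2 := by linarith
  have ht0 : 0 ≤ t := by positivity
  have ht1 : t < 1 := by rw [ht, div_lt_one h2k]; linarith
  have hpos : ∀ θ : ℝ, 0 < 1 + t * Real.cos (2 * θ) := fun θ => by
    nlinarith [Real.neg_one_le_cos (2 * θ)]
  have hcos : ∀ θ : ℝ, Real.cos (2 * (Real.pi / 2 - θ)) = -Real.cos (2 * θ) := fun θ => by
    rw [← Real.cos_pi_sub]; congr 1; ring
  have hneg : ∀ θ : ℝ, 0 < 1 - t * Real.cos (2 * θ) := fun θ => by
    nlinarith [Real.cos_le_one (2 * θ)]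
  have hc1 : Continuous fun θ : ℝ => 1 / Real.sqrt (1 + t * Real.cos (2 * θ)) :=
    continuous_const.div (by fun_prop) fun θ => (Real.sqrt_pos.2 (hpos θ)).ne'
  have hc2 : Continuous fun θ : ℝ => 1 / Real.sqrt (1 - t * Real.cos (2 * θ)) :=
    continuous_const.div (by fun_prop) fun θ => (Real.sqrt_pos.2 (hneg θ)).ne'
  rw [intervalIntegral.integral_add (hc1.intervalIntegrable _ _) (hc2.intervalIntegrable _ _)]
  -- The reflection `θ ↦ π/2 - θ` changes the sign of `cos 2θ`, so the two summands have equal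
  -- integrals.
  have hrefl := intervalIntegral.integral_comp_sub_left (a := 0) (b := Real.pi / 2)
    (fun θ => 1 / Real.sqrt (1 + t * Real.cos (2 * θ))) (Real.pi / 2)
  simp only [hcos, mul_neg, ← sub_eq_add_neg, sub_zero, sub_self] at hrefl
  rw [hrefl, ← two_mul, ellipticK, ellipticF, mul_comm _ (Real.sqrt _),
    ← intervalIntegral.integral_const_mul]
  congr 1
  refine intervalIntegral.integral_congr fun θ _ => ?_
  have hsplit : 1 - k ^ 2 * Real.sin θ ^ 2 = (2 - k ^ 2) / 2 * (1 + t * Real.cos (2 * θ)) := by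
    rw [ht, Real.cos_two_mul, Real.sin_sq]
    field_simp
    ring
  have h1 : 0 < Real.sqrt ((2 - k ^ 2) / 2) := Real.sqrt_pos.2 (by positivity)
  have h3 := Real.sqrt_pos.2 (hpos θ)
  simp only [hsplit]
  rw [Real.sqrt_mul (by positivity)]
  field_simp

/-- The parameter `k²/(2 - k²)` increases with `k`, so the integrand of `ellipticK_mul_sqrt` grows
pointwise. -/
lemma ellipticK_sq_mul_le {k l : ℝ} (h0 : 0 ≤ k) (hkl : k ≤ l) (hl : l ^ 2 < 1) :
    ellipticK k ^ 2 * (2 - k ^ 2) ≤ ellipticK l ^ 2 * (2 - l ^ 2) := by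
  have hk : k ^ 2 ≤ l ^ 2 := by gcongr
  have hk1 : k ^ 2 < 1 := by linarith
  have hle : 2 * (ellipticK k * Real.sqrt ((2 - k ^ 2) / 2)) ≤
      2 * (ellipticK l * Real.sqrt ((2 - l ^ 2) / 2)) := by
    rw [ellipticK_mul_sqrt hk1, ellipticK_mul_sqrt hl]
    have hst : k ^ 2 / (2 - k ^ 2) ≤ l ^ 2 / (2 - l ^ 2) := by
      have : 0 < 2 - l ^ 2 := by linarith
      gcongr
    have hint : ∀ m : ℝ, m ^ 2 < 1 → Continuous fun θ : ℝ =>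
        (1 / Real.sqrt (1 + m ^ 2 / (2 - m ^ 2) * Real.cos (2 * θ)) +
        1 / Real.sqrt (1 - m ^ 2 / (2 - m ^ 2) * Real.cos (2 * θ))) := by
      intro m hm
      have h2m : 0 < 2 - m ^ 2 := by linarith
      have ht0 : 0 ≤ m ^ 2 / (2 - m ^ 2) := by positivity
      have ht1 : m ^ 2 / (2 - m ^ 2) < 1 := by rw [div_lt_one h2m]; linarith
      refine (continuous_const.div (by fun_prop) fun θ => (Real.sqrt_pos.2 ?_).ne').add
        (continuous_const.div (by fun_prop) fun θ => (Real.sqrt_pos.2 ?_).ne')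
      · nlinarith [Real.neg_one_le_cos (2 * θ)]
      · nlinarith [Real.cos_le_one (2 * θ)]
    refine intervalIntegral.integral_mono_on (by positivity)
      ((hint k hk1).intervalIntegrable _ _) ((hint l hl).intervalIntegrable _ _) fun θ _ => ?_
    refine inv_sqrt_add_le_of_abs_le_one (div_nonneg (sq_nonneg k) (by linarith)) hst ?_
      (Real.abs_cos_le_one _)
    rw [div_lt_one (by linarith)]
    linarith
  have hnn : 0 ≤ 2 * (ellipticK k * Real.sqrt ((2 - k ^ 2) / 2)) := by
    have := ellipticK_pos hk1
    positivity
  have hsq := pow_le_pow_left₀ hnn hle 2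
  rw [mul_pow, mul_pow, mul_pow, mul_pow, Real.sq_sqrt (by linarith), Real.sq_sqrt (by linarith)]
    at hsq
  linarith

/-! ### Strict monotonicity of `g` and the number `k_L`. -/

lemma quartic_pos (k : ℝ) : 0 < k ^ 4 - k ^ 2 + 1 := by nlinarith [sq_nonneg (k ^ 2 - 1 / 2)]

lemma strictMonoOn_g : StrictMonoOn g (Ico 0 1) := by
  intro k hk l hl hkl
  have hkl2 : k ^ 2 < l ^ 2 := pow_lt_pow_left₀ hkl hk.1 two_ne_zero
  have hl2 : l ^ 2 < 1 := by nlinarith [hl.1, hl.2]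
  have hk2 : k ^ 2 < 1 := by linarith
  have hP := ellipticK_sq_mul_le hk.1 hkl.le hl2
  have hKk := ellipticK_pos hk2
  have hR : Real.sqrt (k ^ 4 - k ^ 2 + 1) * (2 - l ^ 2) <
      Real.sqrt (l ^ 4 - l ^ 2 + 1) * (2 - k ^ 2) := by
    refine lt_of_pow_lt_pow_left₀ 2 (mul_nonneg (Real.sqrt_nonneg _) (by linarith)) ?_
    rw [mul_pow, mul_pow, Real.sq_sqrt (quartic_pos k).le, Real.sq_sqrt (quartic_pos l).le]
    -- Three times this product is the difference of the two squared sides.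
    have h1 : 0 < (l ^ 2 - k ^ 2) * (l ^ 2 + k ^ 2 * (1 - l ^ 2)) :=
      mul_pos (by linarith)
        (add_pos_of_pos_of_nonneg (by nlinarith [sq_nonneg k])
          (mul_nonneg (sq_nonneg k) (by linarith)))
    nlinarith
  have hRl := Real.sqrt_pos.2 (quartic_pos l)
  set R := Real.sqrt (k ^ 4 - k ^ 2 + 1)
  set S := Real.sqrt (l ^ 4 - l ^ 2 + 1)
  have h1 : ellipticK k ^ 2 * (2 - k ^ 2) * (R * (2 - l ^ 2)) <
      ellipticK l ^ 2 * (2 - l ^ 2) * (S * (2 - k ^ 2)) :=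
    (mul_lt_mul_of_pos_left hR (mul_pos (by positivity) (by linarith))).trans_le
      (mul_le_mul_of_nonneg_right hP (mul_nonneg hRl.le (by linarith)))
  have h2 : ellipticK k ^ 2 * R < ellipticK l ^ 2 * S := by
    have h3 : 0 < (2 - k ^ 2) * (2 - l ^ 2) := mul_pos (by linarith) (by linarith)
    refine lt_of_mul_lt_mul_right ?_ h3.le
    linarith
  simp only [g]
  change 64 * ellipticK k ^ 2 * R < 64 * ellipticK l ^ 2 * S
  linarith

/-- The complete integral has a logarithmic singularity at `k = 1`. -/
lemma log_le_ellipticK {k ε : ℝ} (hε : 0 < ε) (hk : k ^ 2 + ε ^ 2 = 1) :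
    Real.log (1 / ε) ≤ ellipticK k := by
  have hk1 : k ^ 2 < 1 := by nlinarith
  have hπ := Real.pi_gt_three
  have hx : ∀ θ ∈ Icc 0 (Real.pi / 2), 0 < Real.pi / 2 + ε - θ := fun θ hθ => by
    linarith [hθ.2]
  have hint : IntervalIntegrable (fun θ => 1 / (Real.pi / 2 + ε - θ)) MeasureTheory.volume 0
      (Real.pi / 2) := by
    refine ContinuousOn.intervalIntegrable ?_
    rw [uIcc_of_le (by positivity)]
    exact continuousOn_const.div (by fun_prop) fun θ hθ => (hx θ hθ).ne'
  have h1 : ∫ θ in (0 : ℝ)..(Real.pi / 2), 1 / (Real.pi / 2 + ε - θ) =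
      Real.log ((Real.pi / 2 + ε) / ε) := by
    rw [intervalIntegral.integral_comp_sub_left (fun x => 1 / x) (Real.pi / 2 + ε),
      integral_one_div_of_pos (by linarith) (by linarith)]
    congr 2 <;> ring
  have h2 : ∫ θ in (0 : ℝ)..(Real.pi / 2), 1 / (Real.pi / 2 + ε - θ) ≤ ellipticK k := by
    refine intervalIntegral.integral_mono_on (by positivity) hint
      ((continuous_integrand hk1).intervalIntegrable _ _) fun θ hθ => ?_
    -- Here `1 - k² sin² θ = cos² θ + ε² sin² θ ≤ (cos θ + ε)²`, and `cos θ ≤ π/2 - θ`.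
    refine one_div_le_one_div_of_le (Real.sqrt_pos.2 (one_sub_pos hk1 θ)) ?_
    rw [Real.sqrt_le_left (hx θ hθ).le]
    have hc0 : 0 ≤ Real.cos θ := Real.cos_nonneg_of_mem_Icc ⟨by linarith [hθ.1], hθ.2⟩
    have hc1 : Real.cos θ ≤ Real.pi / 2 - θ := by
      rw [← Real.sin_pi_div_two_sub]
      exact Real.sin_le (by linarith [hθ.2])
    have hs := Real.sin_sq_add_cos_sq θ
    have hc2 : Real.cos θ ^ 2 ≤ (Real.pi / 2 - θ) ^ 2 := by gcongr
    have h3 : 0 ≤ (Real.pi / 2 - θ) * ε := mul_nonneg (by linarith) hε.le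
    nlinarith [mul_nonneg (sq_nonneg ε) (sq_nonneg (Real.cos θ))]
  refine (Real.log_le_log (by positivity) ?_).trans (h1 ▸ h2)
  gcongr
  linarith

lemma continuousOn_g : ContinuousOn g (Ico 0 1) := by
  have h : ContinuousOn ellipticK (Ico 0 1) :=
    contDiffOn_ellipticK.continuousOn.mono fun k hk => by
      have := hk.1; have := hk.2; change k ^ 2 < 1; nlinarith
  unfold g
  fun_prop

lemma exists_le_g {L : ℝ} (hL : 0 < L) : ∃ k ∈ Ioo (0 : ℝ) 1, L ^ 2 ≤ g k := by
  -- The complementary modulus `e^(-L)` forces `K ≥ L`; with `R ≥ 1/2` this gives `g ≥ 32 L²`.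
  set ε := Real.exp (-L) with hε
  have h0 : 0 < ε := Real.exp_pos _
  have h1 : ε < 1 := by simpa [hε] using hL
  have h2 : 0 < 1 - ε ^ 2 := by nlinarith
  have hk : Real.sqrt (1 - ε ^ 2) ^ 2 + ε ^ 2 = 1 := by rw [Real.sq_sqrt h2.le]; ring
  refine ⟨Real.sqrt (1 - ε ^ 2), ⟨Real.sqrt_pos.2 h2, ?_⟩, ?_⟩
  · rw [Real.sqrt_lt' one_pos]; nlinarith
  · have hK := log_le_ellipticK h0 hk
    rw [hε, one_div, ← Real.exp_neg, neg_neg, Real.log_exp, ← hε] at hK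
    set k := Real.sqrt (1 - ε ^ 2)
    have hR : 1 / 2 ≤ Real.sqrt (k ^ 4 - k ^ 2 + 1) :=
      Real.le_sqrt_of_sq_le (by nlinarith [sq_nonneg (k ^ 2 - 1 / 2)])
    have hK2 : L ^ 2 ≤ ellipticK k ^ 2 := by gcongr
    have : L ^ 2 * (1 / 2) ≤ ellipticK k ^ 2 * Real.sqrt (k ^ 4 - k ^ 2 + 1) := by gcongr
    simp only [g]
    nlinarith [sq_nonneg L]

lemma existsUnique_g_eq {L : ℝ} (hL : 4 * Real.pi < L) :
    ∃! kL : ℝ, kL ∈ Ioo (0 : ℝ) 1 ∧ g kL = L ^ 2 := by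
  have hL0 : 0 < L := lt_trans (by positivity) hL
  obtain ⟨k, hk, hgk⟩ := exists_le_g hL0
  -- Since `K(0) = π/2`, this is exactly the condition `L > 4π`.
  have hg0 : g 0 < L ^ 2 := by
    have : g 0 = (4 * Real.pi) ^ 2 := by simp [g, ellipticK_zero]; ring
    rw [this]
    gcongr
  obtain ⟨l, hl, hgl⟩ := intermediate_value_Icc hk.1.le
    (continuousOn_g.mono fun x hx => ⟨hx.1, hx.2.trans_lt hk.2⟩) ⟨hg0.le, hgk⟩
  have hl0 : l ≠ 0 := fun h => by rw [h] at hgl; linarith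
  refine ⟨l, ⟨⟨lt_of_le_of_ne hl.1 hl0.symm, hl.2.trans_lt hk.2⟩, hgl⟩, ?_⟩
  rintro m ⟨hm, hgm⟩
  exact strictMonoOn_g.injOn ⟨hm.1.le, hm.2⟩ ⟨hl.1, hl.2.trans_lt hk.2⟩ (hgm.trans hgl.symm)

end Schamel

namespace Schamel

/-! ### Smooth functions of two variables as smooth curves in the Fréchet space -/

/-- The partial derivative in the first variable. -/
noncomputable def partialFst (G : ℝ × ℝ → ℝ) (p : ℝ × ℝ) : ℝ := fderiv ℝ G p (1, 0)

/-- The partial derivative in the second variable. -/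
noncomputable def partialSnd (G : ℝ × ℝ → ℝ) (p : ℝ × ℝ) : ℝ := fderiv ℝ G p (0, 1)

section Partial

variable {I : Set ℝ} {G : ℝ × ℝ → ℝ}

lemma contDiffOn_partialFst (hI : IsOpen I) (hG : ContDiffOn ℝ ∞ G (I ×ˢ univ)) :
    ContDiffOn ℝ ∞ (partialFst G) (I ×ˢ univ) :=
  (hG.fderiv_of_isOpen (hI.prod isOpen_univ) (by simp)).clm_apply contDiffOn_const

lemma contDiffOn_partialSnd (hI : IsOpen I) (hG : ContDiffOn ℝ ∞ G (I ×ˢ univ)) :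
    ContDiffOn ℝ ∞ (partialSnd G) (I ×ˢ univ) :=
  (hG.fderiv_of_isOpen (hI.prod isOpen_univ) (by simp)).clm_apply contDiffOn_const

lemma contDiffOn_iterate_partialSnd (hI : IsOpen I) (hG : ContDiffOn ℝ ∞ G (I ×ˢ univ)) (j : ℕ) :
    ContDiffOn ℝ ∞ (partialSnd^[j] G) (I ×ˢ univ) := by
  induction j with
  | zero => exact hG
  | succ j ih => rw [Function.iterate_succ_apply']; exact contDiffOn_partialSnd hI ih

lemma contDiffAt_of_mem (hI : IsOpen I) (hG : ContDiffOn ℝ ∞ G (I ×ˢ univ)) {t : ℝ} (ht : t ∈ I)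
    (x : ℝ) : ContDiffAt ℝ ∞ G (t, x) :=
  hG.contDiffAt ((hI.prod isOpen_univ).mem_nhds ⟨ht, trivial⟩)

lemma hasDerivAt_partialFst (hI : IsOpen I) (hG : ContDiffOn ℝ ∞ G (I ×ˢ univ)) {t : ℝ}
    (ht : t ∈ I) (x : ℝ) : HasDerivAt (fun s => G (s, x)) (partialFst G (t, x)) t :=
  HasFDerivAt.comp_hasDerivAt (f := fun s : ℝ => (s, x)) t
    ((contDiffAt_of_mem hI hG ht x).differentiableAt (by simp)).hasFDerivAt
    ((hasDerivAt_id t).prodMk (hasDerivAt_const t x))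

lemma hasDerivAt_partialSnd (hI : IsOpen I) (hG : ContDiffOn ℝ ∞ G (I ×ˢ univ)) {t : ℝ}
    (ht : t ∈ I) (x : ℝ) : HasDerivAt (fun y => G (t, y)) (partialSnd G (t, x)) x :=
  HasFDerivAt.comp_hasDerivAt (f := fun y : ℝ => (t, y)) x
    ((contDiffAt_of_mem hI hG ht x).differentiableAt (by simp)).hasFDerivAt
    ((hasDerivAt_const x t).prodMk (hasDerivAt_id x))

lemma partialSnd_partialFst (hI : IsOpen I) (hG : ContDiffOn ℝ ∞ G (I ×ˢ univ)) :
    EqOn (partialSnd (partialFst G)) (partialFst (partialSnd G)) (I ×ˢ univ) := by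
  rintro ⟨t, x⟩ ⟨ht, -⟩
  have hc := contDiffAt_of_mem hI hG ht x
  have hd : DifferentiableAt ℝ (fderiv ℝ G) (t, x) :=
    (hc.fderiv_right (m := ∞) (by simp)).differentiableAt (by simp)
  have happ : ∀ v w : ℝ × ℝ,
      fderiv ℝ (fun p => fderiv ℝ G p v) (t, x) w = fderiv ℝ (fderiv ℝ G) (t, x) w v := by
    intro v w
    rw [fderiv_clm_apply hd (differentiableAt_const v)]
    simp
  have hsymm : IsSymmSndFDerivAt ℝ G (t, x) :=
    (contDiffAt_infty.1 hc 2).isSymmSndFDerivAt (by simp)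
  change fderiv ℝ (fun p => fderiv ℝ G p (1, 0)) (t, x) (0, 1) =
    fderiv ℝ (fun p => fderiv ℝ G p (0, 1)) (t, x) (1, 0)
  rw [happ, happ]
  exact hsymm _ _

lemma partialSnd_congr (hI : IsOpen I) {H : ℝ × ℝ → ℝ} (h : EqOn G H (I ×ˢ univ)) :
    EqOn (partialSnd G) (partialSnd H) (I ×ˢ univ) := fun p hp => by
  have : G =ᶠ[𝓝 p] H := h.eventuallyEq_of_mem ((hI.prod isOpen_univ).mem_nhds hp)
  simp only [partialSnd, this.fderiv_eq]

/-- Lets the `j`-th seminorm of a difference quotient of `G` be read as a difference quotient of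
`∂_x^j G`. -/
lemma iterate_partialSnd_partialFst (hI : IsOpen I) (hG : ContDiffOn ℝ ∞ G (I ×ˢ univ)) (j : ℕ) :
    EqOn (partialSnd^[j] (partialFst G)) (partialFst (partialSnd^[j] G)) (I ×ˢ univ) := by
  induction j with
  | zero => exact fun _ _ => rfl
  | succ j ih =>
    rw [Function.iterate_succ_apply', Function.iterate_succ_apply']
    exact (partialSnd_congr hI ih).trans
      (partialSnd_partialFst hI (contDiffOn_iterate_partialSnd hI hG j))

lemma iteratedDeriv_slice (hI : IsOpen I) (hG : ContDiffOn ℝ ∞ G (I ×ˢ univ)) {t : ℝ}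
    (ht : t ∈ I) (j : ℕ) :
    iteratedDeriv j (fun x => G (t, x)) = fun x => (partialSnd^[j] G) (t, x) := by
  induction j with
  | zero => simp
  | succ j ih =>
    rw [iteratedDeriv_succ, ih, Function.iterate_succ_apply']
    ext x
    exact (hasDerivAt_partialSnd hI (contDiffOn_iterate_partialSnd hI hG j) ht x).deriv

/-- Difference quotients in the first variable converge uniformly on compact sets of the second. -/
lemma eventually_slope_sub_partialFst_le (hI : IsOpen I) (hG : ContDiffOn ℝ ∞ G (I ×ˢ univ))
    {t : ℝ} (ht : t ∈ I) {S : Set ℝ} (hS : IsCompact S) {ε : ℝ} (hε : 0 < ε) :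
    ∀ᶠ h in 𝓝[≠] (0 : ℝ), ∀ x ∈ S,
      |h⁻¹ * (G (t + h, x) - G (t, x)) - partialFst G (t, x)| ≤ ε := by
  have hc := (contDiffOn_partialFst hI hG).continuousOn
  have hev : ∀ᶠ s in 𝓝 t, ∀ x ∈ S, |partialFst G (s, x) - partialFst G (t, x)| < ε := by
    refine hS.eventually_forall_of_forall_eventually fun x hx => ?_
    have h1 : ContinuousAt (partialFst G) (t, x) :=
      hc.continuousAt ((hI.prod isOpen_univ).mem_nhds ⟨ht, trivial⟩)
    have h2 : ContinuousAt (fun p : ℝ × ℝ => partialFst G (t, p.2)) (t, x) :=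
      ContinuousAt.comp (x := (t, x)) (f := fun p : ℝ × ℝ => (t, p.2)) h1 (by fun_prop)
    exact (h1.sub h2).abs.eventually_lt continuousAt_const (by simpa using hε)
  obtain ⟨δ, hδ, hball⟩ := Metric.eventually_nhds_iff_ball.1 (hev.and (hI.mem_nhds ht))
  have hh : ∀ᶠ h in 𝓝[≠] (0 : ℝ), h ∈ Metric.ball (0 : ℝ) δ :=
    mem_nhdsWithin_of_mem_nhds (Metric.ball_mem_nhds 0 hδ)
  filter_upwards [hh, self_mem_nhdsWithin] with h hhδ hh0 x hx
  have hth : t + h ∈ Metric.ball t δ := by simpa [dist_eq_norm] using hhδ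
  -- Subtracting the linear term `s ∂_t G(t, x)` leaves a function of `s` with derivative at most
  -- `ε`, uniformly in `x ∈ S`.
  have hmv := Convex.norm_image_sub_le_of_norm_hasDerivWithin_le (𝕜 := ℝ)
    (f := fun s => G (s, x) - s * partialFst G (t, x))
    (f' := fun s => partialFst G (s, x) - partialFst G (t, x)) (C := ε) (s := Metric.ball t δ)
    (fun s hs => by
      have h1 := (hasDerivAt_partialFst hI hG (hball s hs).2 x).sub
        ((hasDerivAt_id s).mul_const (partialFst G (t, x)))
      rw [one_mul] at h1
      exact h1.hasDerivWithinAt)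
    (fun s hs => ((hball s hs).1 x hx).le) (convex_ball t δ) (Metric.mem_ball_self hδ) hth
  have hne : h ≠ 0 := hh0
  have heq : h⁻¹ * (G (t + h, x) - G (t, x)) - partialFst G (t, x) =
      h⁻¹ * (G (t + h, x) - (t + h) * partialFst G (t, x) -
        (G (t, x) - t * partialFst G (t, x))) := by
    field_simp
    ring
  rw [heq, abs_mul, abs_inv, inv_mul_le_iff₀ (abs_pos.2 hne), mul_comm |h|]
  simpa using hmv

/-- Smooth functions on `I × ℝ` which are `L`-periodic in the second variable. -/
def IsSmoothPeriodicFamily (L : ℝ) (I : Set ℝ) (G : ℝ × ℝ → ℝ) : Prop :=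
  ContDiffOn ℝ ∞ G (I ×ˢ univ) ∧ ∀ t ∈ I, ∀ x, G (t, x + L) = G (t, x)

variable {L : ℝ}

lemma IsSmoothPeriodicFamily.partialFst (hI : IsOpen I) (hG : IsSmoothPeriodicFamily L I G) :
    IsSmoothPeriodicFamily L I (partialFst G) := by
  refine ⟨contDiffOn_partialFst hI hG.1, fun t ht x => ?_⟩
  refine (hasDerivAt_partialFst hI hG.1 ht (x + L)).unique
    ((hasDerivAt_partialFst hI hG.1 ht x).congr_of_eventuallyEq ?_)
  filter_upwards [hI.mem_nhds ht] with s hs using hG.2 s hs x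

lemma IsSmoothPeriodicFamily.iterate_partialFst (hI : IsOpen I)
    (hG : IsSmoothPeriodicFamily L I G) (n : ℕ) :
    IsSmoothPeriodicFamily L I (Schamel.partialFst^[n] G) := by
  induction n with
  | zero => exact hG
  | succ n ih => rw [Function.iterate_succ_apply']; exact ih.partialFst hI

/-- A smooth periodic function as an element of `SmoothPeriodic L`. -/
def SmoothPeriodic.of (f : ℝ → ℝ) (hf : ContDiff ℝ ∞ f) (hp : Function.Periodic f L) :
    SmoothPeriodic L :=
  (⟨f, hf, hp⟩ : smoothPeriodicSubmodule L)

lemma IsSmoothPeriodicFamily.contDiff_slice (hG : IsSmoothPeriodicFamily L I G) {t : ℝ}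
    (ht : t ∈ I) : ContDiff ℝ ∞ fun x => G (t, x) :=
  hG.1.comp_contDiff (contDiff_prodMk_right t) fun _ => ⟨ht, trivial⟩

open Classical in
/-- The curve in `C^∞_per` given by a smooth family, extended by zero. -/
noncomputable def IsSmoothPeriodicFamily.curve (hG : IsSmoothPeriodicFamily L I G) (t : ℝ) :
    SmoothPeriodic L :=
  if ht : t ∈ I then SmoothPeriodic.of (fun x => G (t, x)) (hG.contDiff_slice ht) (hG.2 t ht)
  else 0

lemma IsSmoothPeriodicFamily.coe_curve (hG : IsSmoothPeriodicFamily L I G) {t : ℝ} (ht : t ∈ I) :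
    (hG.curve t : ℝ → ℝ) = fun x => G (t, x) := by
  have h : hG.curve t = SmoothPeriodic.of (fun x => G (t, x)) (hG.contDiff_slice ht) (hG.2 t ht) :=
    dif_pos ht
  rw [h]
  rfl

lemma IsSmoothPeriodicFamily.derivRestrict_curve (hI : IsOpen I)
    (hG : IsSmoothPeriodicFamily L I G) {t : ℝ} (ht : t ∈ I) (j : ℕ) (x : Icc (0 : ℝ) L) :
    SmoothPeriodic.derivRestrict L j (hG.curve t) x = (partialSnd^[j] G) (t, x) := by
  change iteratedDeriv j (hG.curve t : ℝ → ℝ) x = _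
  rw [hG.coe_curve ht, iteratedDeriv_slice hI hG.1 ht]

lemma IsSmoothPeriodicFamily.isSmoothCurveOn (hI : IsOpen I)
    (hG : IsSmoothPeriodicFamily L I G) : IsSmoothCurveOn hG.curve I := by
  refine ⟨fun n => (hG.iterate_partialFst hI n).curve, fun t _ => rfl, fun n t ht => ?_⟩
  rw [SmoothPeriodic.withSeminorms.tendsto_nhds]
  intro j ε hε
  have hn := hG.iterate_partialFst hI n
  have hn' := hG.iterate_partialFst hI (n + 1)
  have hth : ∀ᶠ h in 𝓝[≠] (0 : ℝ), t + h ∈ I := by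
    refine mem_nhdsWithin_of_mem_nhds ?_
    have hcont : ContinuousAt (fun h : ℝ => t + h) 0 := by fun_prop
    exact hcont.preimage_mem_nhds (hI.mem_nhds (by simpa using ht))
  filter_upwards [hth, eventually_slope_sub_partialFst_le hI
    (contDiffOn_iterate_partialSnd hI hn.1 j) ht (isCompact_Icc (a := 0) (b := L)) (half_pos hε)]
    with h hmem hle
  change ‖SmoothPeriodic.derivRestrict L j
    (h⁻¹ • (hn.curve (t + h) - hn.curve t) - hn'.curve t)‖ < ε
  -- The uniform estimate is not strict, hence `ε/2`.
  refine lt_of_le_of_lt ((ContinuousMap.norm_le _ (half_pos hε).le).2 fun x => ?_) (half_lt_self hε)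
  rw [map_sub, map_smul, map_sub]
  simp only [ContinuousMap.sub_apply, ContinuousMap.smul_apply, smul_eq_mul]
  rw [hn.derivRestrict_curve hI hmem, hn.derivRestrict_curve hI ht, hn'.derivRestrict_curve hI ht,
    Function.iterate_succ_apply' Schamel.partialFst n G,
    iterate_partialSnd_partialFst hI hn.1 j ⟨ht, trivial⟩]
  exact hle x x.2

end Partial

end Schamel

namespace Schamel

/-! ### The travelling waves -/

section Wave

variable {L k : ℝ}

/-- `R² - (2k² - 1)² = 3k²(1 - k²) > 0`. This makes `waveRoot` positive. -/
lemma sqrt_quartic_gt (hk0 : 0 < k) (hk : k ^ 2 < 1) :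
    2 * k ^ 2 - 1 < Real.sqrt (k ^ 4 - k ^ 2 + 1) := by
  refine Real.lt_sqrt_of_sq_lt ?_
  nlinarith [mul_pos (pow_pos hk0 2) (sub_pos.2 hk)]

lemma one_lt_waveSpeed (hk : k ^ 2 < 1) (hm : 0 < mTilde L k) : 1 < waveSpeed L k := by
  change 1 < L ^ 2 / mTilde L k
  rw [one_lt_div hm]
  have h1 := ellipticK_pos hk
  have h2 := Real.sqrt_pos.2 (quartic_pos k)
  have : 0 < 64 * ellipticK k ^ 2 * Real.sqrt (k ^ 4 - k ^ 2 + 1) := by positivity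
  simp only [mTilde]
  linarith

/-- The square root of the profile. -/
noncomputable def waveRoot (L k x : ℝ) : ℝ :=
  80 / 3 * (ellipticK k ^ 2 / mTilde L k) * (Real.sqrt (k ^ 4 - k ^ 2 + 1) - (2 * k ^ 2 - 1) +
    3 * k ^ 2 * jacobiCN (2 * ellipticK k / L * x) k ^ 2)

/-- Substituting `L² = m̃ + 64K²R` cancels the `-1` in the constant term, and `5/12 · 64 = 80/3`. -/
lemma phi_eq_waveRoot_sq (hm : mTilde L k ≠ 0) (x : ℝ) : phi L k x = waveRoot L k x ^ 2 := by
  have hL2 : L ^ 2 = mTilde L k + 64 * ellipticK k ^ 2 * Real.sqrt (k ^ 4 - k ^ 2 + 1) := by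
    simp only [mTilde]; ring
  simp only [phi, waveRoot]
  rw [hL2]
  congr 1
  field_simp
  ring

lemma waveRoot_pos (hk0 : 0 < k) (hk : k ^ 2 < 1) (hm : 0 < mTilde L k) (x : ℝ) :
    0 < waveRoot L k x := by
  have h1 := ellipticK_pos hk
  have h2 := sub_pos.2 (sqrt_quartic_gt hk0 hk)
  unfold waveRoot
  positivity

lemma phi_periodic (hL : L ≠ 0) (hk : k ^ 2 < 1) : Function.Periodic (phi L k) L := by
  intro x
  have : 2 * ellipticK k / L * (x + L) = 2 * ellipticK k / L * x + 2 * ellipticK k := by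
    field_simp
  simp only [phi, this, jacobiCN_sq_add hk]

/-- The wave equation after substituting `c q² = 4κ` with `q = 2K/L`, `c - 1 = 64κR` and `φ'' = 2w'²
+ 2ww''`. The `y³` and `y²` coefficients cancel outright; the other two need `hR`. -/
lemma wave_identity {κ R p y : ℝ} (hR : R ^ 2 = p ^ 2 - p + 1) :
    -(4 * κ) * (2 * (80 * p * κ) ^ 2 * (4 * y * (1 - y) * (1 - p + p * y)) +
        2 * (80 / 3 * κ * (R - (2 * p - 1) + 3 * p * y)) * (80 * p * κ) *
          (2 * ((1 - 2 * y) * (1 - p + p * y) + p * y * (1 - y)))) +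
      64 * κ * R * (80 / 3 * κ * (R - (2 * p - 1) + 3 * p * y)) ^ 2 -
      (80 / 3 * κ * (R - (2 * p - 1) + 3 * p * y)) ^ 3 +
      -204800 / 27 * κ ^ 3 * ((R - (2 * p - 1)) ^ 2 * (2 * R + (2 * p - 1))) = 0 := by
  linear_combination 6400 / 27 * 48 * κ ^ 3 * (R - (2 * p - 1) + 9 * p * y) * hR

lemma hasDerivAt_waveRoot (hk : k ^ 2 < 1) (x : ℝ) :
    HasDerivAt (waveRoot L k) (80 * k ^ 2 * (ellipticK k ^ 2 / mTilde L k) *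
      (2 * ellipticK k / L) * cnSqDeriv (2 * ellipticK k / L * x) k) x := by
  have h1 : HasDerivAt (fun x => 2 * ellipticK k / L * x) (2 * ellipticK k / L) x := by
    simpa using (hasDerivAt_id x).const_mul (2 * ellipticK k / L)
  have h2 := (hasDerivAt_jacobiCN_sq hk (2 * ellipticK k / L * x)).comp x h1
  refine (((h2.const_mul (3 * k ^ 2)).const_add
    (Real.sqrt (k ^ 4 - k ^ 2 + 1) - (2 * k ^ 2 - 1))).const_mul
    (80 / 3 * (ellipticK k ^ 2 / mTilde L k))).congr_deriv ?_
  ring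

lemma solvesWaveODE_phi (hL : L ≠ 0) (hk0 : 0 < k) (hk : k ^ 2 < 1) (hm : 0 < mTilde L k) :
    SolvesWaveODE (waveSpeed L k) (waveA L k) (phi L k) := by
  have hphi : phi L k = fun x => waveRoot L k x ^ 2 := funext (phi_eq_waveRoot_sq hm.ne')
  set q := 2 * ellipticK k / L with hq
  set κ := ellipticK k ^ 2 / mTilde L k with hκ
  have hd1 : deriv (phi L k) =
      fun x => 2 * waveRoot L k x * (80 * k ^ 2 * κ * q * cnSqDeriv (q * x) k) := by
    ext x
    rw [hphi]
    refine HasDerivAt.deriv (((hasDerivAt_waveRoot hk x).pow 2).congr_deriv ?_)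
    simp [hq, hκ]
  intro x
  set y := jacobiCN (q * x) k ^ 2 with hy
  have h1 : HasDerivAt (fun x => q * x) q x := by simpa using (hasDerivAt_id x).const_mul q
  have h2 := (hasDerivAt_cnSqDeriv hk (q * x)).comp x h1
  have hd2 : deriv (deriv (phi L k)) x =
      q ^ 2 * (2 * (80 * k ^ 2 * κ) ^ 2 * (4 * y * (1 - y) * (1 - k ^ 2 + k ^ 2 * y)) +
        2 * waveRoot L k x * (80 * k ^ 2 * κ) *
          (2 * ((1 - 2 * y) * (1 - k ^ 2 + k ^ 2 * y) + k ^ 2 * y * (1 - y)))) := by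
    rw [hd1]
    refine HasDerivAt.deriv ((((hasDerivAt_waveRoot hk x).const_mul 2).mul
      (h2.const_mul (80 * k ^ 2 * κ * q))).congr_deriv ?_)
    rw [hy, ← cnSqDeriv_sq hk (q * x)]
    simp only [Function.comp_apply]
    ring
  have hpow : phi L k x ^ (3 / 2 : ℝ) = waveRoot L k x ^ 3 := by
    have hp := (waveRoot_pos hk0 hk hm x).le
    rw [phi_eq_waveRoot_sq hm.ne', ← Real.rpow_natCast, ← Real.rpow_mul hp,
      ← Real.rpow_natCast]
    norm_num
  have hc1 : waveSpeed L k * q ^ 2 = 4 * κ := by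
    change L ^ 2 / mTilde L k * q ^ 2 = _
    rw [hq, hκ]
    field_simp
    ring
  have hc2 : waveSpeed L k - 1 = 64 * κ * Real.sqrt (k ^ 4 - k ^ 2 + 1) := by
    change L ^ 2 / mTilde L k - 1 = _
    rw [hκ]
    field_simp
    simp only [mTilde]
    ring_nf
  have hA : waveA L k = -204800 / 27 * κ ^ 3 *
      ((Real.sqrt (k ^ 4 - k ^ 2 + 1) - (2 * k ^ 2 - 1)) ^ 2 *
        (2 * Real.sqrt (k ^ 4 - k ^ 2 + 1) + (2 * k ^ 2 - 1))) := by
    rw [waveA, hκ]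
    field_simp
  have hR : Real.sqrt (k ^ 4 - k ^ 2 + 1) ^ 2 = (k ^ 2) ^ 2 - k ^ 2 + 1 := by
    rw [Real.sq_sqrt (quartic_pos k).le]; ring
  have key := wave_identity (κ := κ) (y := y) hR
  have hroot : waveRoot L k x = 80 / 3 * κ * (Real.sqrt (k ^ 4 - k ^ 2 + 1) - (2 * k ^ 2 - 1) +
    3 * k ^ 2 * y) := rfl
  rw [hd2, hpow, hc2, hA, phi_eq_waveRoot_sq hm.ne', neg_mul, ← mul_assoc, hc1, hroot]
  rw [neg_mul] at key
  exact key

end Wave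

lemma contDiffOn_phi {L : ℝ} {I : Set ℝ} (hI : ∀ k ∈ I, k ^ 2 < 1 ∧ mTilde L k ≠ 0) :
    ContDiffOn ℝ ∞ (fun p : ℝ × ℝ => phi L p.1 p.2) (I ×ˢ univ) := by
  have hK : ContDiffOn ℝ ∞ (fun p : ℝ × ℝ => ellipticK p.1) (I ×ˢ univ) :=
    contDiffOn_ellipticK.comp contDiff_fst.contDiffOn fun p hp => (hI p.1 hp.1).1
  have hk : ContDiffOn ℝ ∞ (fun p : ℝ × ℝ => p.1) (I ×ˢ univ) := contDiff_fst.contDiffOn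
  have hm : ContDiffOn ℝ ∞ (fun p : ℝ × ℝ => mTilde L p.1) (I ×ˢ univ) := by
    have hR : ContDiff ℝ ∞ fun p : ℝ × ℝ => Real.sqrt (p.1 ^ 4 - p.1 ^ 2 + 1) :=
      ContDiff.sqrt (by fun_prop) fun p => (quartic_pos p.1).ne'
    exact contDiffOn_const.sub ((contDiffOn_const.mul (hK.pow 2)).mul hR.contDiffOn)
  have hm0 : ∀ p ∈ I ×ˢ (univ : Set ℝ), mTilde L p.1 ≠ 0 := fun p hp => (hI p.1 hp.1).2
  -- The modulus is the parameter, hence the first coordinate here, but the second argument of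
  -- `jacobiAm`.
  have harg : ContDiffOn ℝ ∞ (fun p : ℝ × ℝ => (2 * ellipticK p.1 / L * p.2, p.1))
      (I ×ˢ univ) :=
    (((contDiffOn_const.mul hK).div_const L).mul contDiff_snd.contDiffOn).prodMk hk
  have hcn : ContDiffOn ℝ ∞ (fun p : ℝ × ℝ => jacobiCN (2 * ellipticK p.1 / L * p.2) p.1)
      (I ×ˢ univ) :=
    (contDiffOn_jacobiAm.comp harg fun p hp => (hI p.1 hp.1).1).cos
  have h2 : ContDiffOn ℝ ∞ (fun p : ℝ × ℝ => L ^ 2 - 64 * (2 * p.1 ^ 2 - 1) * ellipticK p.1 ^ 2)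
      (I ×ˢ univ) := by fun_prop
  have h3 : ContDiffOn ℝ ∞ (fun p : ℝ × ℝ => 80 * p.1 ^ 2 * ellipticK p.1 ^ 2)
      (I ×ˢ univ) := by fun_prop
  exact ((contDiffOn_const.mul ((h2.div hm hm0).sub contDiffOn_const)).add
    ((h3.div hm hm0).mul (hcn.pow 2))).pow 2

end Schamel

theorem corollary3p7 (L : ℝ) (hL : 4 * Real.pi < L) :
    (∃! kL : ℝ, kL ∈ Set.Ioo (0 : ℝ) 1 ∧ Schamel.g kL = L ^ 2) ∧
    ∀ kL : ℝ, kL ∈ Set.Ioo (0 : ℝ) 1 → Schamel.g kL = L ^ 2 →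
      (∀ k ∈ Set.Ioo 0 kL,
        1 < Schamel.waveSpeed L k ∧
        (∀ x, 0 < Schamel.phi L k x) ∧
        ContDiff ℝ ∞ (Schamel.phi L k) ∧
        Function.Periodic (Schamel.phi L k) L ∧
        Schamel.SolvesWaveODE (Schamel.waveSpeed L k) (Schamel.waveA L k) (Schamel.phi L k)) ∧
      ∃ Φ : ℝ → Schamel.SmoothPeriodic L,
        (∀ k ∈ Set.Ioo 0 kL, (Φ k : ℝ → ℝ) = Schamel.phi L k) ∧
        Schamel.IsSmoothCurveOn Φ (Set.Ioo 0 kL) := by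
  have hL0 : L ≠ 0 := (lt_trans (by positivity) hL).ne'
  refine ⟨Schamel.existsUnique_g_eq hL, fun kL hkL hg => ?_⟩
  have hk1 : ∀ k ∈ Set.Ioo 0 kL, k ^ 2 < 1 := fun k hk =>
    Schamel.sq_lt_one_of_mem ⟨hk.1, hk.2.trans hkL.2⟩
  -- `m̃(k) = L² - g(k) = g(k_L) - g(k)`.
  have hm : ∀ k ∈ Set.Ioo 0 kL, 0 < Schamel.mTilde L k := fun k hk => by
    have : Schamel.g k < Schamel.g kL :=
      Schamel.strictMonoOn_g ⟨hk.1.le, hk.2.trans hkL.2⟩ ⟨hkL.1.le, hkL.2⟩ hk.2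
    rw [hg] at this
    exact sub_pos.2 this
  have hfam : Schamel.IsSmoothPeriodicFamily L (Set.Ioo 0 kL) (fun p => Schamel.phi L p.1 p.2) :=
    ⟨Schamel.contDiffOn_phi fun k hk => ⟨hk1 k hk, (hm k hk).ne'⟩,
      fun k hk => Schamel.phi_periodic hL0 (hk1 k hk)⟩
  refine ⟨fun k hk => ⟨Schamel.one_lt_waveSpeed (hk1 k hk) (hm k hk), fun x => ?_, ?_,
    Schamel.phi_periodic hL0 (hk1 k hk),
    Schamel.solvesWaveODE_phi hL0 hk.1 (hk1 k hk) (hm k hk)⟩,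
    hfam.curve, fun k hk => hfam.coe_curve hk, hfam.isSmoothCurveOn isOpen_Ioo⟩
  · rw [Schamel.phi_eq_waveRoot_sq (hm k hk).ne']
    exact pow_pos (Schamel.waveRoot_pos hk.1 (hk1 k hk) (hm k hk) x) 2
  · exact hfam.contDiff_slice hk
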